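/- Let $\mathcal P[0,1]$ be the set of Borel probability measures on $[0,1]$, and write $m_P=\mathbb E_P[X]$ for the mean of $P\in\mathcal P[0,1]$. For $m\in(0,1)$ and $P\in\mathcal P[0,1]$ define $$\operatorname{KL_{inf}}(P,m)=\inf\{\operatorname{KL}(P,P') : P'\in\mathcal P[0,1],\ m_{P'}=m\},\qquad \widetilde{\operatorname{KL_{inf}}}(P,m)=\max_{\lambda\in[-1,1]}\mathbb E_P[\log(1-\lambda(X-m))],$$ and call $\lambda\in[-\frac1m,\frac1{1-m}]$ a dual maximizer for $\operatorname{KL_{inf}}(P,m)$ if it maximizes $\lambda\mapsto\mathbb E_P[\log(1-\lambda(X-m))]$ (with values in $[-\infty,\infty)$, $\log 0=-\infty$) over $[-\frac1m,\frac1{1-m}]$. Let $m\in(0,1)$ and let $(P_n)\subset\mathcal P[0,1]$ be a sequence with $m_{P_n}<m$ for all $n$ that converges weakly to some $P_\infty\in\mathcal P[0,1]$ with $m_{P_\infty}=m$ and $\operatorname{Var}[P_\infty]>0$. Then, for every $n$, $0<\operatorname{KL_{inf}}(P_n,m)<\infty$ and there is a unique dual maximizer $\lambda_{P_n}$ for $\operatorname{KL_{inf}}(P_n,m)$,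 and, as $n\to\infty$, $$\operatorname{KL_{inf}}(P_n,m)=\frac12\,\frac{(\mathbb E_{P_n}[X-m])^2}{\mathbb E_{P_n}[(X-m)^2]}+o\big((\lambda_{P_n})^2\big),$$ $$\lim_{n\to\infty}\frac{\Big(\log\frac{1+\lambda_{P_n}m}{1-\lambda_{P_n}(1-m)}\Big)^2}{2\operatorname{KL_{inf}}(P_n,m)}=\frac1{\operatorname{Var}[P_\infty]},\qquad \lim_{n\to\infty}\frac{\widetilde{\operatorname{KL_{inf}}}(P_n,m)}{\operatorname{KL_{inf}}(P_n,m)}=1.$$ -/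

import Mathlib

open MeasureTheory
open scoped ENNReal

noncomputable section

namespace BoundedMean

/-- `𝒫[0,1]`: Borel probability measures on `[0,1]`, with the topology of weak convergence
(Mathlib's topology on `ProbabilityMeasure`). -/
abbrev Dist01 : Type := ProbabilityMeasure unitInterval

/-- The mean `m_P = E_P[X]`. -/
def mean (P : Dist01) : ℝ := ∫ x, (x : ℝ) ∂(P : Measure unitInterval)

/-- `KL_inf(P, m) = inf { KL(P, P') : P' ∈ 𝒫[0,1], m_{P'} = m }`. -/
def klInf (P : Dist01) (m : ℝ) : ℝ≥0∞ :=
  ⨅ (P' : Dist01) (_ : mean P' = m),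
    InformationTheory.klDiv (P : Measure unitInterval) (P' : Measure unitInterval)

/-- The expectation `E_P[f⁺] - E_P[f⁻]` of an extended-real function. -/
def extExpectation (P : Dist01) (f : unitInterval → EReal) : EReal :=
  ((∫⁻ x, (f x).toENNReal ∂(P : Measure unitInterval) : ℝ≥0∞) : EReal) -
    ((∫⁻ x, (-f x).toENNReal ∂(P : Measure unitInterval) : ℝ≥0∞) : EReal)

/-- The dual objective `l ↦ E_P[log(1 - l (X - m))]`, with `log 0 = -∞`: at the endpoints
`l = -1/m` and `l = 1/(1-m)` of the dual domain the argument of the logarithm vanishes at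
`x = 0`, respectively at `x = 1`, and the expectation may be `-∞`. -/
def dualObjective (P : Dist01) (m l : ℝ) : EReal :=
  extExpectation P fun x => ENNReal.log (ENNReal.ofReal (1 - l * ((x : ℝ) - m)))

/-- The dual domain `[-1/m, 1/(1-m)]`. -/
def dualDomain (m : ℝ) : Set ℝ := Set.Icc (-(1 / m)) (1 / (1 - m))

/-- `l` maximizes the dual objective over the dual domain. -/
def IsDualMaximizer (P : Dist01) (m l : ℝ) : Prop :=
  l ∈ dualDomain m ∧ IsMaxOn (dualObjective P m) (dualDomain m) l

/-- `KL̃_inf(P, m) = max_{l ∈ [-1,1]} E_P[log(1 - l (X - m))]`. -/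
def klInfTilde (P : Dist01) (m : ℝ) : EReal :=
  ⨆ l ∈ Set.Icc (-1 : ℝ) 1, dualObjective P m l

end BoundedMean

end

open BoundedMean

namespace BoundedMean

open Filter Topology

/-! Write Z = X - m and g(l) = E_P[log(1 - lZ)]. Duality is only needed for |l| ≤ 1/2, where every
integrand is continuous and bounded. Gibbs' inequality gives g(l) ≤ KL(P, P') for every admissible
P' (`ofReal_integral_log_le_klDiv`). If g'(l) = 0, then dP' = dP / (1 - lZ) is itself admissible and
attains the bound (`klInf_eq_of_stationary`), and by concavity l is a dual maximizer.

Such an l exists for large n: -g'(l) = E[Z] + l E[Z²] + O(l²) is negative at 0, and positive at a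
small fixed ε once E[Z] is close to 0, because E[Z²] tends to σ = Var[P_∞] > 0
(`exists_stationary`). Uniqueness identifies this l with λ, so λ tends to 0 from above. Stationarity
then gives -E[Z]/λ → σ, and the second-order expansion of g gives KL_inf/λ² → σ/2. The first two
asymptotic claims follow from these limits; the third holds because λ eventually lies in [-1, 1].

For every n, existence of the maximizer follows from semicontinuity on the compact dual domain, and
uniqueness from strict concavity of log. -/

lemma integrable_of_continuous (P : Dist01) {f : unitInterval → ℝ} (hf : Continuous f) :
    Integrable f (P : Measure unitInterval) :=
  hf.integrable_of_hasCompactSupport (HasCompactSupport.of_compactSpace f)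

/-! ### Bounds on `1 - l (x - m)` -/

lemma abs_sub_le_one {m : ℝ} (hm : m ∈ Set.Ioo (0 : ℝ) 1) (x : unitInterval) :
    |(x : ℝ) - m| ≤ 1 := by
  have h0 := x.2.1
  have h1 := x.2.2
  rw [abs_le]
  constructor <;> linarith [hm.1, hm.2]

/-- The expression is affine in x, with values `1 + l m` at 0 and `1 - l (1 - m)` at 1; both are
nonnegative on the dual domain. -/
lemma one_sub_mul_nonneg {m l : ℝ} (hm : m ∈ Set.Ioo (0 : ℝ) 1) (hl : l ∈ dualDomain m)
    (x : unitInterval) : 0 ≤ 1 - l * ((x : ℝ) - m) := by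
  have h0 := x.2.1
  have h1 := x.2.2
  have hm0 := hm.1
  have hm1 : 0 < 1 - m := by linarith [hm.2]
  have e1 : -1 ≤ l * m := by
    have := mul_le_mul_of_nonneg_right hl.1 hm0.le
    field_simp at this
    linarith
  have e2 : l * (1 - m) ≤ 1 := by
    have := mul_le_mul_of_nonneg_right hl.2 hm1.le
    field_simp at this
    linarith
  nlinarith [mul_nonneg h0 (sub_nonneg.2 e2), mul_nonneg (sub_nonneg.2 h1) (sub_nonneg.2 e1)]

lemma abs_mul_sub_le_half {m l : ℝ} (hm : m ∈ Set.Ioo (0 : ℝ) 1) (hl : |l| ≤ 1 / 2)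
    (x : unitInterval) : |l * ((x : ℝ) - m)| ≤ 1 / 2 := by
  rw [abs_mul]
  nlinarith [abs_sub_le_one hm x, abs_nonneg l, abs_nonneg ((x : ℝ) - m)]

lemma half_le_one_sub_mul {m l : ℝ} (hm : m ∈ Set.Ioo (0 : ℝ) 1) (hl : |l| ≤ 1 / 2)
    (x : unitInterval) : 1 / 2 ≤ 1 - l * ((x : ℝ) - m) := by
  linarith [(abs_le.1 (abs_mul_sub_le_half hm hl x)).2]

lemma continuous_log_one_sub_mul {m l : ℝ} (hm : m ∈ Set.Ioo (0 : ℝ) 1) (hl : |l| ≤ 1 / 2) :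
    Continuous fun x : unitInterval => Real.log (1 - l * ((x : ℝ) - m)) := by
  refine Continuous.log (by fun_prop) fun x => ?_
  linarith [half_le_one_sub_mul hm hl x]

/-! ### The dual objective as a real integral -/

lemma toENNReal_log_ofReal {y : ℝ} (hy : 0 < y) :
    (ENNReal.log (ENNReal.ofReal y)).toENNReal = ENNReal.ofReal (Real.log y) := by
  rw [ENNReal.log_ofReal_of_pos hy, EReal.real_coe_toENNReal]

lemma toENNReal_neg_log_ofReal {y : ℝ} (hy : 0 < y) :
    (-ENNReal.log (ENNReal.ofReal y)).toENNReal = ENNReal.ofReal (-Real.log y) := by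
  rw [ENNReal.log_ofReal_of_pos hy, ← EReal.coe_neg, EReal.real_coe_toENNReal]

lemma toENNReal_neg_log_ofReal_of_nonpos {y : ℝ} (hy : y ≤ 0) :
    (-ENNReal.log (ENNReal.ofReal y)).toENNReal = ⊤ := by
  rw [ENNReal.log_ofReal, if_pos hy]; simp

/-- Almost sure positivity is essential: `Real.log 0 = 0`, whereas the objective uses log 0 = -∞. -/
lemma dualObjective_eq_integral {P : Dist01} {m l : ℝ}
    (hpos : ∀ᵐ x : unitInterval ∂(P : Measure unitInterval), 0 < 1 - l * ((x : ℝ) - m))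
    (hint : Integrable (fun x : unitInterval => Real.log (1 - l * ((x : ℝ) - m)))
      (P : Measure unitInterval)) :
    dualObjective P m l =
      ((∫ x : unitInterval, Real.log (1 - l * ((x : ℝ) - m)) ∂(P : Measure unitInterval) : ℝ) :
        EReal) := by
  have h1 : ∫⁻ x : unitInterval, (ENNReal.log (ENNReal.ofReal (1 - l * ((x : ℝ) - m)))).toENNReal
      ∂(P : Measure unitInterval) =
      ∫⁻ x : unitInterval, ENNReal.ofReal (Real.log (1 - l * ((x : ℝ) - m)))
        ∂(P : Measure unitInterval) :=
    lintegral_congr_ae (hpos.mono fun x hx => toENNReal_log_ofReal hx)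
  have h2 : ∫⁻ x : unitInterval, (-ENNReal.log (ENNReal.ofReal (1 - l * ((x : ℝ) - m)))).toENNReal
      ∂(P : Measure unitInterval) =
      ∫⁻ x : unitInterval, ENNReal.ofReal (-Real.log (1 - l * ((x : ℝ) - m)))
        ∂(P : Measure unitInterval) :=
    lintegral_congr_ae (hpos.mono fun x hx => toENNReal_neg_log_ofReal hx)
  rw [dualObjective, extExpectation, h1, h2, integral_eq_lintegral_pos_part_sub_lintegral_neg_part
    hint, EReal.coe_sub, EReal.coe_ennreal_toReal, EReal.coe_ennreal_toReal]
  · exact hint.neg.lintegral_lt_top.ne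
  · exact hint.lintegral_lt_top.ne

lemma dualObjective_eq_integral_of_abs_le {P : Dist01} {m l : ℝ} (hm : m ∈ Set.Ioo (0 : ℝ) 1)
    (hl : |l| ≤ 1 / 2) :
    dualObjective P m l =
      ((∫ x : unitInterval, Real.log (1 - l * ((x : ℝ) - m)) ∂(P : Measure unitInterval) : ℝ) :
        EReal) :=
  dualObjective_eq_integral (ae_of_all _ fun x => by linarith [half_le_one_sub_mul hm hl x])
    (integrable_of_continuous P (continuous_log_one_sub_mul hm hl))

/-- An upper bound for `1 - l (x - m)` over the dual domain. -/
noncomputable def dualBound (m : ℝ) : ℝ := 1 + 1 / m + 1 / (1 - m)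

lemma one_le_dualBound {m : ℝ} (hm : m ∈ Set.Ioo (0 : ℝ) 1) : 1 ≤ dualBound m := by
  have h1 : 0 < 1 / m := one_div_pos.2 hm.1
  have h2 : 0 < 1 / (1 - m) := one_div_pos.2 (by linarith [hm.2])
  unfold dualBound; linarith

lemma one_sub_mul_le_dualBound {m l : ℝ} (hm : m ∈ Set.Ioo (0 : ℝ) 1) (hl : l ∈ dualDomain m)
    (x : unitInterval) : 1 - l * ((x : ℝ) - m) ≤ dualBound m := by
  have h1 : 0 < 1 / m := one_div_pos.2 hm.1
  have h2 : 0 < 1 / (1 - m) := one_div_pos.2 (by linarith [hm.2])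
  have h3 : |l| ≤ 1 / m + 1 / (1 - m) := abs_le.2 ⟨by linarith [hl.1], by linarith [hl.2]⟩
  have h4 : -(l * ((x : ℝ) - m)) ≤ |l| := by
    refine (neg_le_abs _).trans ?_
    rw [abs_mul]
    exact mul_le_of_le_one_right (abs_nonneg _) (abs_sub_le_one hm x)
  unfold dualBound; linarith

lemma lintegral_log_lt_top {P : Dist01} {m l : ℝ} (hm : m ∈ Set.Ioo (0 : ℝ) 1)
    (hl : l ∈ dualDomain m) :
    ∫⁻ x : unitInterval, (ENNReal.log (ENNReal.ofReal (1 - l * ((x : ℝ) - m)))).toENNReal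
      ∂(P : Measure unitInterval) < ⊤ := by
  calc _ ≤ ∫⁻ _ : unitInterval, ENNReal.ofReal (Real.log (dualBound m))
      ∂(P : Measure unitInterval) := by
        refine lintegral_mono fun x => ?_
        rw [← toENNReal_log_ofReal (by linarith [one_le_dualBound hm])]
        exact EReal.toENNReal_le_toENNReal (ENNReal.log_le_log
          (ENNReal.ofReal_le_ofReal (one_sub_mul_le_dualBound hm hl x)))
    _ < ⊤ := by simp

/-- In `EReal`, subtracting ⊤ always gives ⊥, so the negative part has finite integral; this
excludes zeros of the argument outside a null set. The positive part is bounded by `Real.log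
(dualBound m)`. -/
lemma integrable_of_dualObjective_ne_bot {P : Dist01} {m l : ℝ} (hm : m ∈ Set.Ioo (0 : ℝ) 1)
    (hl : l ∈ dualDomain m) (h : dualObjective P m l ≠ ⊥) :
    (∀ᵐ x : unitInterval ∂(P : Measure unitInterval), 0 < 1 - l * ((x : ℝ) - m)) ∧
    Integrable (fun x : unitInterval => Real.log (1 - l * ((x : ℝ) - m)))
      (P : Measure unitInterval) := by
  have hneg : ∫⁻ x : unitInterval, (-ENNReal.log (ENNReal.ofReal (1 - l * ((x : ℝ) - m)))).toENNReal
      ∂(P : Measure unitInterval) ≠ ⊤ := by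
    intro hT
    refine h ?_
    rw [dualObjective, extExpectation, hT, EReal.coe_ennreal_top, EReal.sub_top]
  have hmeas : Measurable fun x : unitInterval =>
      (-ENNReal.log (ENNReal.ofReal (1 - l * ((x : ℝ) - m)))).toENNReal := by
    refine EReal.continuous_toENNReal.measurable.comp (Measurable.neg ?_)
    exact ENNReal.measurable_log.comp (by fun_prop)
  have hpos : ∀ᵐ x : unitInterval ∂(P : Measure unitInterval), 0 < 1 - l * ((x : ℝ) - m) := by
    filter_upwards [ae_lt_top hmeas hneg] with x hx
    by_contra hc
    rw [toENNReal_neg_log_ofReal_of_nonpos (not_lt.1 hc)] at hx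
    exact lt_irrefl _ hx
  refine ⟨hpos, ⟨(Real.measurable_log.comp (by fun_prop)).aestronglyMeasurable, ?_⟩⟩
  rw [hasFiniteIntegral_iff_norm]
  calc _ = ∫⁻ x : unitInterval, ((ENNReal.log (ENNReal.ofReal (1 - l * ((x : ℝ) - m)))).toENNReal
        + (-ENNReal.log (ENNReal.ofReal (1 - l * ((x : ℝ) - m)))).toENNReal)
        ∂(P : Measure unitInterval) := by
        refine lintegral_congr_ae (hpos.mono fun x hx => ?_)
        simp only [toENNReal_log_ofReal hx, toENNReal_neg_log_ofReal hx]
        rcases le_total 0 (Real.log (1 - l * ((x : ℝ) - m))) with h0 | h0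
        · rw [ENNReal.ofReal_of_nonpos (neg_nonpos.2 h0), Real.norm_of_nonneg h0, add_zero]
        · rw [ENNReal.ofReal_of_nonpos h0, Real.norm_of_nonpos h0, zero_add]
    _ < ⊤ := by
        rw [lintegral_add_right _ hmeas]
        exact ENNReal.add_lt_top.2 ⟨lintegral_log_lt_top hm hl, hneg.lt_top⟩

/-! ### Existence and uniqueness of the dual maximizer -/

lemma zero_mem_dualDomain {m : ℝ} (hm : m ∈ Set.Ioo (0 : ℝ) 1) : (0 : ℝ) ∈ dualDomain m := by
  have h1 : 0 < 1 / m := one_div_pos.2 hm.1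
  have h2 : 0 < 1 / (1 - m) := one_div_pos.2 (by linarith [hm.2])
  exact ⟨by linarith, h2.le⟩

lemma Icc_subset_dualDomain {m : ℝ} (hm : m ∈ Set.Ioo (0 : ℝ) 1) :
    Set.Icc (-1 : ℝ) 1 ⊆ dualDomain m := by
  have h1 : 1 ≤ 1 / m := (one_le_div hm.1).2 hm.2.le
  have h2 : 1 ≤ 1 / (1 - m) := (one_le_div (by linarith [hm.2])).2 (by linarith [hm.1])
  exact fun l hl => ⟨by linarith [hl.1], by linarith [hl.2]⟩

lemma dualObjective_zero {P : Dist01} {m : ℝ} (hm : m ∈ Set.Ioo (0 : ℝ) 1) :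
    dualObjective P m 0 = 0 := by
  rw [dualObjective_eq_integral_of_abs_le hm (by simp)]; simp

/-- The deficit of the dual objective below the logarithm of `dualBound`. -/
noncomputable def dualDeficit (P : Dist01) (m l : ℝ) : ℝ≥0∞ :=
  ∫⁻ x : unitInterval, (ENNReal.log (ENNReal.ofReal (dualBound m) *
    (ENNReal.ofReal (1 - l * ((x : ℝ) - m)))⁻¹)).toENNReal ∂(P : Measure unitInterval)

/-- Fatou's lemma: the integrand is nonnegative and continuous in l as an extended real, with value
⊤ where the argument of the logarithm vanishes. -/
lemma lowerSemicontinuous_dualDeficit (P : Dist01) (m : ℝ) :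
    LowerSemicontinuous (dualDeficit P m) := by
  have hc : Continuous fun y : ℝ =>
      (ENNReal.log (ENNReal.ofReal (dualBound m) * (ENNReal.ofReal y)⁻¹)).toENNReal := by
    refine EReal.continuous_toENNReal.comp (ENNReal.continuous_log.comp ?_)
    exact (ENNReal.continuous_const_mul ENNReal.ofReal_ne_top).comp
      (continuous_inv.comp ENNReal.continuous_ofReal)
  intro l y hy
  refine eventually_lt_of_lt_liminf (lt_of_lt_of_le hy ?_)
  refine le_trans (le_of_eq ?_) (lintegral_liminf_le fun i => ?_)
  · refine lintegral_congr fun x => ?_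
    symm
    refine Tendsto.liminf_eq ?_
    have : Continuous fun l : ℝ => 1 - l * ((x : ℝ) - m) := by fun_prop
    exact (hc.comp this).tendsto l
  · exact hc.measurable.comp (by fun_prop)

/-- Turns maximizing the objective into minimizing a lower semicontinuous function. The identity is
first proved additively in `ℝ≥0∞`, so that no infinite quantities are subtracted. -/
lemma dualObjective_eq_sub_dualDeficit {P : Dist01} {m l : ℝ} (hm : m ∈ Set.Ioo (0 : ℝ) 1)
    (hl : l ∈ dualDomain m) :
    dualObjective P m l = (Real.log (dualBound m) : EReal) - (dualDeficit P m l : EReal) := by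
  have hC := one_le_dualBound hm
  have hlogC : 0 ≤ Real.log (dualBound m) := Real.log_nonneg hC
  have hmeas : Measurable fun x : unitInterval =>
      (-ENNReal.log (ENNReal.ofReal (1 - l * ((x : ℝ) - m)))).toENNReal := by
    refine EReal.continuous_toENNReal.measurable.comp (Measurable.neg ?_)
    exact ENNReal.measurable_log.comp (by fun_prop)
  have hmeas' : Measurable fun x : unitInterval =>
      (ENNReal.log (ENNReal.ofReal (1 - l * ((x : ℝ) - m)))).toENNReal := by
    refine EReal.continuous_toENNReal.measurable.comp ?_
    exact ENNReal.measurable_log.comp (by fun_prop)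
  have key : (∫⁻ x : unitInterval, (ENNReal.log (ENNReal.ofReal
      (1 - l * ((x : ℝ) - m)))).toENNReal ∂(P : Measure unitInterval)) + dualDeficit P m l =
      ENNReal.ofReal (Real.log (dualBound m)) + ∫⁻ x : unitInterval,
        (-ENNReal.log (ENNReal.ofReal (1 - l * ((x : ℝ) - m)))).toENNReal
          ∂(P : Measure unitInterval) := by
    have hconst : ENNReal.ofReal (Real.log (dualBound m)) =
        ∫⁻ _ : unitInterval, ENNReal.ofReal (Real.log (dualBound m))
          ∂(P : Measure unitInterval) := by simp
    rw [hconst, dualDeficit, ← lintegral_add_left hmeas', ← lintegral_add_right _ hmeas]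
    refine lintegral_congr fun x => ?_
    rcases (one_sub_mul_nonneg hm hl x).eq_or_lt with h0 | h0
    · rw [← h0]
      have : ENNReal.ofReal (dualBound m) ≠ 0 := by
        simp only [ne_eq, ENNReal.ofReal_eq_zero, not_le]; linarith
      simp [ENNReal.mul_top this]
    · have hle := one_sub_mul_le_dualBound hm hl x
      have hlog := Real.log_le_log h0 hle
      rw [toENNReal_log_ofReal h0, toENNReal_neg_log_ofReal h0, ← ENNReal.ofReal_inv_of_pos h0,
        ← ENNReal.ofReal_mul (by linarith), toENNReal_log_ofReal (by positivity),
        ← div_eq_mul_inv, Real.log_div (by linarith) h0.ne']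
      rcases le_total 0 (Real.log (1 - l * ((x : ℝ) - m))) with h1 | h1
      · rw [ENNReal.ofReal_of_nonpos (neg_nonpos.2 h1), add_zero,
          ← ENNReal.ofReal_add h1 (by linarith)]
        congr 1; ring
      · rw [ENNReal.ofReal_of_nonpos h1, zero_add, ← ENNReal.ofReal_add hlogC (by linarith)]
        congr 1
  have hA : ∫⁻ x : unitInterval, (ENNReal.log (ENNReal.ofReal
      (1 - l * ((x : ℝ) - m)))).toENNReal ∂(P : Measure unitInterval) ≠ ⊤ :=
    (lintegral_log_lt_top hm hl).ne
  rw [dualObjective, extExpectation]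
  generalize (∫⁻ x : unitInterval, (ENNReal.log (ENNReal.ofReal
      (1 - l * ((x : ℝ) - m)))).toENNReal ∂(P : Measure unitInterval)) = A at key hA ⊢
  generalize (∫⁻ x : unitInterval, (-ENNReal.log (ENNReal.ofReal
      (1 - l * ((x : ℝ) - m)))).toENNReal ∂(P : Measure unitInterval)) = B at key ⊢
  generalize dualDeficit P m l = G at key ⊢
  by_cases hB : B = ⊤
  · have hG : G = ⊤ := by
      subst hB
      rw [add_top] at key
      exact (ENNReal.add_eq_top.1 key).resolve_left hA
    rw [hB, hG, EReal.coe_ennreal_top, EReal.sub_top, EReal.sub_top]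
  · have hG : G ≠ ⊤ := by
      intro hG
      rw [hG, add_top] at key
      exact ENNReal.add_ne_top.2 ⟨ENNReal.ofReal_ne_top, hB⟩ key.symm
    have key' := congrArg ENNReal.toReal key
    rw [ENNReal.toReal_add hA hG, ENNReal.toReal_add ENNReal.ofReal_ne_top hB,
      ENNReal.toReal_ofReal hlogC] at key'
    rw [← EReal.coe_ennreal_toReal hA, ← EReal.coe_ennreal_toReal hB,
      ← EReal.coe_ennreal_toReal hG, ← EReal.coe_sub, ← EReal.coe_sub]
    congr 1; linarith

lemma exists_isDualMaximizer (P : Dist01) {m : ℝ} (hm : m ∈ Set.Ioo (0 : ℝ) 1) :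
    ∃ l, IsDualMaximizer P m l := by
  obtain ⟨l, hl, hmin⟩ := LowerSemicontinuousOn.exists_isMinOn (s := dualDomain m)
    ⟨0, zero_mem_dualDomain hm⟩ isCompact_Icc
    ((lowerSemicontinuous_dualDeficit P m).lowerSemicontinuousOn _)
  refine ⟨l, hl, fun l' hl' => ?_⟩
  change dualObjective P m l' ≤ dualObjective P m l
  rw [dualObjective_eq_sub_dualDeficit hm hl, dualObjective_eq_sub_dualDeficit hm hl']
  exact EReal.sub_le_sub le_rfl (EReal.coe_ennreal_le_coe_ennreal_iff.2 (hmin hl'))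

lemma IsDualMaximizer.ne_bot {P : Dist01} {m l : ℝ} (hm : m ∈ Set.Ioo (0 : ℝ) 1)
    (h : IsDualMaximizer P m l) : dualObjective P m l ≠ ⊥ := by
  have h0 : dualObjective P m 0 ≤ dualObjective P m l := h.2 (zero_mem_dualDomain hm)
  rw [dualObjective_zero hm] at h0
  intro hb
  rw [hb] at h0
  exact absurd h0 (by simp)

/-- At the midpoint of two maximizers, concavity of log must hold with equality almost surely.
Strict concavity then forces X = m almost surely, against `mean P ≠ m`. -/
lemma IsDualMaximizer.unique {P : Dist01} {m l₁ l₂ : ℝ} (hm : m ∈ Set.Ioo (0 : ℝ) 1)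
    (hP : mean P ≠ m) (h₁ : IsDualMaximizer P m l₁) (h₂ : IsDualMaximizer P m l₂) :
    l₁ = l₂ := by
  by_contra hne
  obtain ⟨p₁, i₁⟩ := integrable_of_dualObjective_ne_bot hm h₁.1 (h₁.ne_bot hm)
  obtain ⟨p₂, i₂⟩ := integrable_of_dualObjective_ne_bot hm h₂.1 (h₂.ne_bot hm)
  set l : ℝ := (1 / 2) * l₁ + (1 / 2) * l₂ with hl
  have hlD : l ∈ dualDomain m :=
    convex_Icc _ _ h₁.1 h₂.1 (a := (1 / 2 : ℝ)) (b := (1 / 2 : ℝ)) (by norm_num) (by norm_num)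
      (by norm_num)
  have e : ∀ x : unitInterval, 1 - l * ((x : ℝ) - m) = (1 / 2 : ℝ) • (1 - l₁ * ((x : ℝ) - m)) +
      (1 / 2 : ℝ) • (1 - l₂ * ((x : ℝ) - m)) := fun x => by
    simp only [hl, smul_eq_mul]; ring
  have p : ∀ᵐ x : unitInterval ∂(P : Measure unitInterval), 0 < 1 - l * ((x : ℝ) - m) := by
    filter_upwards [p₁, p₂] with x h1 h2
    rw [e, smul_eq_mul, smul_eq_mul]; positivity
  have hconc : ∀ᵐ x : unitInterval ∂(P : Measure unitInterval),
      1 / 2 * Real.log (1 - l₁ * ((x : ℝ) - m)) + 1 / 2 * Real.log (1 - l₂ * ((x : ℝ) - m)) ≤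
        Real.log (1 - l * ((x : ℝ) - m)) := by
    filter_upwards [p₁, p₂] with x h1 h2
    rw [e]
    exact strictConcaveOn_log_Ioi.concaveOn.2 h1 h2 (by norm_num) (by norm_num) (by norm_num)
  have iavg : Integrable (fun x : unitInterval => 1 / 2 * Real.log (1 - l₁ * ((x : ℝ) - m)) +
      1 / 2 * Real.log (1 - l₂ * ((x : ℝ) - m))) (P : Measure unitInterval) :=
    (i₁.const_mul _).add (i₂.const_mul _)
  have i : Integrable (fun x : unitInterval => Real.log (1 - l * ((x : ℝ) - m)))
      (P : Measure unitInterval) := by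
    refine (iavg.abs.add (integrable_const (Real.log (dualBound m)))).mono'
      (Real.measurable_log.comp (by fun_prop)).aestronglyMeasurable ?_
    filter_upwards [p, hconc] with x hx hc
    have hup := Real.log_le_log hx (one_sub_mul_le_dualBound hm hlD x)
    have hC := Real.log_nonneg (one_le_dualBound hm)
    simp only [Pi.add_apply, Real.norm_eq_abs]
    set A := 1 / 2 * Real.log (1 - l₁ * ((x : ℝ) - m)) + 1 / 2 * Real.log (1 - l₂ * ((x : ℝ) - m))
    rw [abs_le]
    constructor
    · linarith [neg_abs_le A]
    · linarith [abs_nonneg A]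
  have q₁ : dualObjective P m l ≤ dualObjective P m l₁ := h₁.2 hlD
  have q₂ : dualObjective P m l ≤ dualObjective P m l₂ := h₂.2 hlD
  rw [dualObjective_eq_integral p i, dualObjective_eq_integral p₁ i₁, EReal.coe_le_coe_iff] at q₁
  rw [dualObjective_eq_integral p i, dualObjective_eq_integral p₂ i₂, EReal.coe_le_coe_iff] at q₂
  have hzero : ∫ x : unitInterval, (Real.log (1 - l * ((x : ℝ) - m)) -
      (1 / 2 * Real.log (1 - l₁ * ((x : ℝ) - m)) + 1 / 2 * Real.log (1 - l₂ * ((x : ℝ) - m))))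
        ∂(P : Measure unitInterval) = 0 := by
    refine le_antisymm ?_ (integral_nonneg_of_ae (hconc.mono fun x hx => sub_nonneg.2 hx))
    rw [integral_sub i iavg, integral_add (i₁.const_mul _) (i₂.const_mul _), integral_const_mul,
      integral_const_mul]
    linarith
  rw [integral_eq_zero_iff_of_nonneg_ae (hconc.mono fun x hx => sub_nonneg.2 hx) (i.sub iavg)]
    at hzero
  have hxm : ∀ᵐ x : unitInterval ∂(P : Measure unitInterval), (x : ℝ) = m := by
    filter_upwards [p₁, p₂, hzero] with x h1 h2 h3
    by_contra hx
    have hy : 1 - l₁ * ((x : ℝ) - m) ≠ 1 - l₂ * ((x : ℝ) - m) := fun h =>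
      hne (mul_right_cancel₀ (sub_ne_zero.2 hx) (by linarith))
    have hstrict := strictConcaveOn_log_Ioi.2 h1 h2 hy (by norm_num : (0 : ℝ) < 1 / 2)
      (by norm_num : (0 : ℝ) < 1 / 2) (by norm_num)
    rw [← e] at hstrict
    simp only [smul_eq_mul] at hstrict
    simp only [Pi.zero_apply] at h3
    linarith
  exact hP (by rw [mean, integral_congr_ae hxm]; simp)

/-! ### Duality for small multipliers -/

lemma integral_one_sub_mul (P : Dist01) (m l : ℝ) :
    ∫ x : unitInterval, (1 - l * ((x : ℝ) - m)) ∂(P : Measure unitInterval) =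
      1 - l * (mean P - m) := by
  have hi : Integrable (fun x : unitInterval => (x : ℝ)) (P : Measure unitInterval) :=
    integrable_of_continuous P (by fun_prop)
  have hz : Integrable (fun x : unitInterval => (x : ℝ) - m) (P : Measure unitInterval) :=
    hi.sub (integrable_const _)
  rw [integral_sub (integrable_const _) (hz.const_mul _), integral_const_mul,
    integral_sub hi (integrable_const _)]
  simp [mean]

/-- Weak duality. -/
lemma ofReal_integral_log_le_klDiv {P P' : Dist01} {m l : ℝ} (hm : m ∈ Set.Ioo (0 : ℝ) 1)
    (hl : |l| ≤ 1 / 2) (hP' : mean P' = m) :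
    ENNReal.ofReal (∫ x : unitInterval, Real.log (1 - l * ((x : ℝ) - m))
      ∂(P : Measure unitInterval)) ≤
      InformationTheory.klDiv (P : Measure unitInterval) (P' : Measure unitInterval) := by
  by_cases htop : InformationTheory.klDiv (P : Measure unitInterval) (P' : Measure unitInterval) = ⊤
  · rw [htop]; exact le_top
  obtain ⟨hac, hint⟩ := InformationTheory.klDiv_ne_top_iff.1 htop
  rw [InformationTheory.klDiv_of_ac_of_integrable hac hint]
  refine ENNReal.ofReal_le_ofReal ?_
  set f : unitInterval → ℝ := fun x => Real.log (1 - l * ((x : ℝ) - m)) with hf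
  have hfc : Continuous f := continuous_log_one_sub_mul hm hl
  have hexp : Integrable (fun x => Real.exp (f x)) (P' : Measure unitInterval) :=
    integrable_of_continuous P' (Real.continuous_exp.comp hfc)
  have hone : ∫ x, Real.exp (f x) ∂(P' : Measure unitInterval) = 1 := by
    have : (fun x => Real.exp (f x)) = fun x : unitInterval => 1 - l * ((x : ℝ) - m) := by
      ext x
      exact Real.exp_log (by linarith [half_le_one_sub_mul hm hl x])
    rw [this, integral_one_sub_mul, hP']; ring
  have hfi := integrable_of_continuous P hfc
  have hprob := isProbabilityMeasure_tilted hexp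
  -- Gibbs' inequality for P against P' tilted by f. The normalizing constant is 1 because P' has
  -- mean m, so the tilt only subtracts f from the log-likelihood ratio.
  have h0 := InformationTheory.integral_llr_add_sub_measure_univ_nonneg
    (hac.trans (absolutelyContinuous_tilted hexp)) (integrable_llr_tilted_right hac hfi hint hexp)
  rw [integral_llr_tilted_right hac hfi hexp hint, hone] at h0
  simp only [Real.log_one, probReal_univ] at h0 ⊢
  linarith

lemma ofReal_integral_log_le_klInf {P : Dist01} {m l : ℝ} (hm : m ∈ Set.Ioo (0 : ℝ) 1)
    (hl : |l| ≤ 1 / 2) :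
    ENNReal.ofReal (∫ x : unitInterval, Real.log (1 - l * ((x : ℝ) - m))
      ∂(P : Measure unitInterval)) ≤ klInf P m :=
  le_iInf₂ fun _ hP' => ofReal_integral_log_le_klDiv hm hl hP'

lemma continuous_div_one_sub_mul {m l : ℝ} (hm : m ∈ Set.Ioo (0 : ℝ) 1) (hl : |l| ≤ 1 / 2) :
    Continuous fun x : unitInterval => ((x : ℝ) - m) / (1 - l * ((x : ℝ) - m)) := by
  refine Continuous.div (by fun_prop) (by fun_prop) fun x => ?_
  linarith [half_le_one_sub_mul hm hl x]

/-- Strong duality at a stationary point of the dual objective. -/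
lemma klInf_eq_of_stationary {P : Dist01} {m l : ℝ} (hm : m ∈ Set.Ioo (0 : ℝ) 1)
    (hl : |l| ≤ 1 / 2)
    (hst : ∫ x : unitInterval, ((x : ℝ) - m) / (1 - l * ((x : ℝ) - m))
      ∂(P : Measure unitInterval) = 0) :
    klInf P m = ENNReal.ofReal (∫ x : unitInterval, Real.log (1 - l * ((x : ℝ) - m))
      ∂(P : Measure unitInterval)) := by
  refine le_antisymm ?_ (ofReal_integral_log_le_klInf hm hl)
  have hne : ∀ x : unitInterval, 0 < 1 - l * ((x : ℝ) - m) := fun x => by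
    linarith [half_le_one_sub_mul hm hl x]
  have hqi := integrable_of_continuous P (continuous_div_one_sub_mul hm hl)
  -- The optimal P' has density 1/(1 - lz) with respect to P, where z = x - m. As 1/(1 - lz) = 1 + l
  -- z/(1 - lz), stationarity gives it total mass 1, and likewise mean m.
  set f : unitInterval → ℝ := fun x => -Real.log (1 - l * ((x : ℝ) - m)) with hf
  have hfc : Continuous f := (continuous_log_one_sub_mul hm hl).neg
  have hexpf : ∀ x, Real.exp (f x) = (1 - l * ((x : ℝ) - m))⁻¹ := fun x => by
    rw [hf, Real.exp_neg, Real.exp_log (hne x)]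
  have hexp : Integrable (fun x => Real.exp (f x)) (P : Measure unitInterval) :=
    integrable_of_continuous P (Real.continuous_exp.comp hfc)
  have hone : ∫ x, Real.exp (f x) ∂(P : Measure unitInterval) = 1 := by
    have : (fun x => Real.exp (f x)) = fun x : unitInterval =>
        1 + l * (((x : ℝ) - m) / (1 - l * ((x : ℝ) - m))) := by
      ext x
      have := (hne x).ne'
      rw [hexpf]
      field_simp
      ring
    rw [this, integral_add (integrable_const _) (hqi.const_mul _), integral_const_mul, hst]
    simp
  have hfi := integrable_of_continuous P hfc
  have hprob := isProbabilityMeasure_tilted hexp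
  let P' : Dist01 := ⟨(P : Measure unitInterval).tilted f, hprob⟩
  have hP' : mean P' = m := by
    have hcoe : (P' : Measure unitInterval) = (P : Measure unitInterval).tilted f := rfl
    rw [mean, hcoe, integral_tilted, hone]
    have : (fun x : unitInterval => (Real.exp (f x) / 1) • (x : ℝ)) = fun x : unitInterval =>
        ((x : ℝ) - m) / (1 - l * ((x : ℝ) - m)) + m * Real.exp (f x) := by
      ext x
      rw [hexpf, smul_eq_mul]; ring
    rw [this, integral_add hqi (hexp.const_mul _), integral_const_mul, hst, hone]
    ring
  refine (iInf₂_le P' hP').trans ?_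
  have hself : Integrable (llr (P : Measure unitInterval) P) (P : Measure unitInterval) :=
    (integrable_zero _ _ _).congr (llr_self _).symm
  have hac : (P : Measure unitInterval) ≪ (P : Measure unitInterval) :=
    Measure.AbsolutelyContinuous.rfl
  change InformationTheory.klDiv (P : Measure unitInterval) ((P : Measure unitInterval).tilted f) ≤ _
  rw [InformationTheory.klDiv_of_ac_of_integrable (absolutelyContinuous_tilted hexp)
    (integrable_llr_tilted_right hac hfi hself hexp), integral_llr_tilted_right hac hfi hexp hself,
    hone, integral_congr_ae (llr_self _)]
  refine ENNReal.ofReal_le_ofReal (le_of_eq ?_)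
  simp [hf, integral_neg]

/-- Applying log u ≤ u - 1 to the ratio of the two arguments gives a tangent-line bound whose linear
term integrates to 0. This covers every k in the dual domain, endpoints included. -/
lemma isDualMaximizer_of_stationary {P : Dist01} {m l : ℝ} (hm : m ∈ Set.Ioo (0 : ℝ) 1)
    (hl : |l| ≤ 1 / 2)
    (hst : ∫ x : unitInterval, ((x : ℝ) - m) / (1 - l * ((x : ℝ) - m))
      ∂(P : Measure unitInterval) = 0) :
    IsDualMaximizer P m l := by
  have hl' := abs_le.1 hl
  refine ⟨Icc_subset_dualDomain hm ⟨by linarith, by linarith⟩, fun k hk => ?_⟩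
  change dualObjective P m k ≤ dualObjective P m l
  by_cases hbot : dualObjective P m k = ⊥
  · rw [hbot]; exact bot_le
  obtain ⟨hpos, hint⟩ := integrable_of_dualObjective_ne_bot hm hk hbot
  have hli := integrable_of_continuous P (continuous_log_one_sub_mul hm hl)
  have hqi := integrable_of_continuous P (continuous_div_one_sub_mul hm hl)
  rw [dualObjective_eq_integral hpos hint, dualObjective_eq_integral_of_abs_le hm hl,
    EReal.coe_le_coe_iff]
  have hle : ∫ x : unitInterval, Real.log (1 - k * ((x : ℝ) - m)) ∂(P : Measure unitInterval) ≤
      ∫ x : unitInterval, (Real.log (1 - l * ((x : ℝ) - m)) +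
        (l - k) * (((x : ℝ) - m) / (1 - l * ((x : ℝ) - m)))) ∂(P : Measure unitInterval) := by
    refine integral_mono_ae hint (hli.add (hqi.const_mul _)) (hpos.mono fun x hx => ?_)
    have hx' : 0 < 1 - l * ((x : ℝ) - m) := by linarith [half_le_one_sub_mul hm hl x]
    have h := Real.log_le_sub_one_of_pos (div_pos hx hx')
    rw [Real.log_div hx.ne' hx'.ne'] at h
    have e : (1 - k * ((x : ℝ) - m)) / (1 - l * ((x : ℝ) - m)) - 1 =
        (l - k) * (((x : ℝ) - m) / (1 - l * ((x : ℝ) - m))) := by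
      rw [div_sub_one hx'.ne', ← mul_div_assoc]
      congr 1; ring
    simp only
    linarith
  rwa [integral_add hli (hqi.const_mul _), integral_const_mul, hst, mul_zero, add_zero] at hle

/-! ### Positivity and finiteness of `klInf` -/

lemma mean_mem_Icc (P : Dist01) : mean P ∈ Set.Icc (0 : ℝ) 1 := by
  have hi : Integrable (fun x : unitInterval => (x : ℝ)) (P : Measure unitInterval) :=
    integrable_of_continuous P (by fun_prop)
  refine ⟨integral_nonneg fun x => x.2.1, ?_⟩
  have := integral_mono hi (integrable_const 1) fun x => x.2.2
  simpa [mean] using this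

lemma neg_sub_two_mul_sq_le_log_one_sub {x : ℝ} (hx : |x| ≤ 1 / 2) :
    -x - 2 * x ^ 2 ≤ Real.log (1 - x) := by
  have hx' := abs_le.1 hx
  have h : 0 < 1 - x := by linarith
  refine le_trans ?_ (Real.one_sub_inv_le_log_of_pos h)
  have : 1 - (1 - x)⁻¹ = -x / (1 - x) := by field_simp; ring
  rw [this, le_div_iff₀ h]
  nlinarith [mul_nonneg (sq_nonneg x) (by linarith : 0 ≤ 1 - 2 * x)]

lemma klInf_pos {P : Dist01} {m : ℝ} (hm : m ∈ Set.Ioo (0 : ℝ) 1) (hP : mean P < m) :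
    0 < klInf P m := by
  have hmean := mean_mem_Icc P
  set a : ℝ := m - mean P with ha
  have ha0 : 0 < a := by linarith
  have ha1 : a ≤ 1 := by linarith [hmean.1, hm.2]
  -- The objective at l is at least l a - 2 l², and l = a/4 maximizes this bound, with value a²/8.
  have hl : |a / 4| ≤ 1 / 2 := by rw [abs_of_pos (by positivity)]; linarith
  refine lt_of_lt_of_le (ENNReal.ofReal_pos.2 ?_) (ofReal_integral_log_le_klInf hm hl)
  have hone : Integrable (fun x : unitInterval => 1 - a / 4 * ((x : ℝ) - m))
      (P : Measure unitInterval) := integrable_of_continuous P (by fun_prop)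
  have hle : ∫ x : unitInterval, ((1 - a / 4 * ((x : ℝ) - m)) - (1 + 2 * (a / 4) ^ 2))
      ∂(P : Measure unitInterval) ≤
      ∫ x : unitInterval, Real.log (1 - a / 4 * ((x : ℝ) - m)) ∂(P : Measure unitInterval) := by
    refine integral_mono (hone.sub (integrable_const _))
      (integrable_of_continuous P (continuous_log_one_sub_mul hm hl)) fun x => ?_
    have h := neg_sub_two_mul_sq_le_log_one_sub (abs_mul_sub_le_half hm hl x)
    have h2 : (a / 4 * ((x : ℝ) - m)) ^ 2 ≤ (a / 4) ^ 2 := by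
      rw [mul_pow]
      exact mul_le_of_le_one_right (sq_nonneg _) ((sq_le_one_iff_abs_le_one _).2 (abs_sub_le_one hm x))
    simp only
    linarith
  refine lt_of_lt_of_le ?_ hle
  rw [integral_sub hone (integrable_const _), integral_one_sub_mul]
  simp only [integral_const, probReal_univ, smul_eq_mul, one_mul]
  have : mean P - m = -a := by rw [ha]; ring
  rw [this]
  nlinarith

lemma klFun_le_sq_add_one {r : ℝ} (hr : 0 ≤ r) : InformationTheory.klFun r ≤ r ^ 2 + 1 := by
  have h := mul_le_mul_of_nonneg_left (Real.log_le_self hr) hr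
  rw [InformationTheory.klFun]
  nlinarith

/-- The density of μ with respect to ν is at most c almost everywhere, so `klFun` of it is bounded.
-/
lemma klDiv_lt_top_of_le_smul {α : Type*} [MeasurableSpace α] {μ ν : Measure α}
    [IsFiniteMeasure μ] [IsFiniteMeasure ν] {c : ℝ≥0∞} (hc : c ≠ ⊤) (h : μ ≤ c • ν) :
    InformationTheory.klDiv μ ν < ⊤ := by
  have hac : μ ≪ ν := (Measure.absolutelyContinuous_of_le h).trans
    (Measure.smul_absolutelyContinuous)
  have hbound : ∀ᵐ x ∂ν, μ.rnDeriv ν x ≤ c := by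
    refine ae_le_of_forall_setLIntegral_le_of_sigmaFinite (Measure.measurable_rnDeriv μ ν)
      fun s _ _ => (Measure.setLIntegral_rnDeriv_le s).trans ?_
    simpa using h s
  rw [InformationTheory.klDiv_eq_lintegral_klFun_of_ac hac]
  calc _ ≤ ∫⁻ _, ENNReal.ofReal (c.toReal ^ 2 + 1) ∂ν := by
        refine lintegral_mono_ae (hbound.mono fun x hx => ENNReal.ofReal_le_ofReal ?_)
        refine (klFun_le_sq_add_one ENNReal.toReal_nonneg).trans ?_
        gcongr
    _ < ⊤ := by
        rw [lintegral_const]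
        exact ENNReal.mul_lt_top ENNReal.ofReal_lt_top (measure_lt_top _ _)

lemma klInf_lt_top {P : Dist01} {m : ℝ} (hm : m ∈ Set.Ioo (0 : ℝ) 1) (hP : mean P < m) :
    klInf P m < ⊤ := by
  have hden : 0 < 1 - mean P := by linarith [hm.2]
  -- The competitor is (1 - t) P + t δ₁, with t chosen to make its mean m; it dominates (1 - t) P.
  set t : ℝ := (m - mean P) / (1 - mean P) with ht
  have ht0 : 0 ≤ t := div_nonneg (by linarith) hden.le
  have ht1 : 0 < 1 - t := by
    have : 1 - t = (1 - m) / (1 - mean P) := by rw [ht]; field_simp; ring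
    rw [this]
    exact div_pos (by linarith [hm.2]) hden
  let ν : Measure unitInterval :=
    ENNReal.ofReal (1 - t) • (P : Measure unitInterval) + ENNReal.ofReal t • Measure.dirac 1
  have hν : IsProbabilityMeasure ν := ⟨by
    simp only [ν, Measure.add_apply, Measure.smul_apply, measure_univ, smul_eq_mul, mul_one]
    rw [← ENNReal.ofReal_add ht1.le ht0]
    simp⟩
  let P' : Dist01 := ⟨ν, hν⟩
  have hi : Continuous fun x : unitInterval => (x : ℝ) := by fun_prop
  have hP' : mean P' = m := by
    have hcoe : (P' : Measure unitInterval) = ν := rfl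
    have h1 : Integrable (fun x : unitInterval => (x : ℝ))
        (ENNReal.ofReal (1 - t) • (P : Measure unitInterval)) :=
      (integrable_of_continuous P hi).smul_measure ENNReal.ofReal_ne_top
    have h2 : Integrable (fun x : unitInterval => (x : ℝ))
        (ENNReal.ofReal t • Measure.dirac (1 : unitInterval)) :=
      (integrable_dirac (by simp)).smul_measure ENNReal.ofReal_ne_top
    rw [mean, hcoe, integral_add_measure h1 h2, integral_smul_measure, integral_smul_measure,
      integral_dirac, ENNReal.toReal_ofReal ht1.le, ENNReal.toReal_ofReal ht0]
    change (1 - t) • mean P + t • (1 : ℝ) = m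
    simp only [smul_eq_mul]
    have : t * (1 - mean P) = m - mean P := by rw [ht]; field_simp
    linarith
  refine (iInf₂_le P' hP').trans_lt (klDiv_lt_top_of_le_smul (c := (ENNReal.ofReal (1 - t))⁻¹) ?_ ?_)
  · simpa using ht1
  · change (P : Measure unitInterval) ≤ (ENNReal.ofReal (1 - t))⁻¹ • ν
    simp only [ν, smul_add, smul_smul]
    rw [ENNReal.inv_mul_cancel (by simpa using ht1) ENNReal.ofReal_ne_top, one_smul]
    exact Measure.le_add_right le_rfl

/-! ### Expansions of the dual objective and its derivative at 0 -/

lemma integral_sub_const_eq (P : Dist01) (m : ℝ) :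
    ∫ x : unitInterval, ((x : ℝ) - m) ∂(P : Measure unitInterval) = mean P - m := by
  have hi : Integrable (fun x : unitInterval => (x : ℝ)) (P : Measure unitInterval) :=
    integrable_of_continuous P (by fun_prop)
  rw [integral_sub hi (integrable_const _)]
  simp [mean]

lemma abs_log_one_sub_add_le {x : ℝ} (hx : |x| ≤ 1 / 2) :
    |Real.log (1 - x) + x + x ^ 2 / 2| ≤ 2 * |x| ^ 3 := by
  have h := Real.abs_log_sub_add_sum_range_le (x := x) (by linarith) 2
  have e : ∑ i ∈ Finset.range 2, x ^ (i + 1) / ((i : ℝ) + 1) + Real.log (1 - x) =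
      Real.log (1 - x) + x + x ^ 2 / 2 := by
    simp [Finset.sum_range_succ]; ring
  rw [e] at h
  refine h.trans ?_
  rw [div_le_iff₀ (by linarith)]
  have : 0 ≤ |x| ^ 3 := by positivity
  norm_num
  nlinarith

lemma abs_integral_le_of_abs_le {P : Dist01} {f : unitInterval → ℝ} {C : ℝ}
    (h : ∀ x, |f x| ≤ C) : |∫ x, f x ∂(P : Measure unitInterval)| ≤ C := by
  have := norm_integral_le_of_norm_le_const (μ := (P : Measure unitInterval)) 
    (ae_of_all _ fun x => (Real.norm_eq_abs (f x)).trans_le (h x))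
  simpa using this

/-- Second-order expansion of the dual objective. -/
lemma abs_integral_log_sub_le {P : Dist01} {m l : ℝ} (hm : m ∈ Set.Ioo (0 : ℝ) 1)
    (hl : |l| ≤ 1 / 2) :
    |(∫ x : unitInterval, Real.log (1 - l * ((x : ℝ) - m)) ∂(P : Measure unitInterval)) -
      (l * (m - mean P) -
        l ^ 2 / 2 * ∫ x : unitInterval, ((x : ℝ) - m) ^ 2 ∂(P : Measure unitInterval))| ≤
      2 * |l| ^ 3 := by
  have h1 := integrable_of_continuous P (continuous_log_one_sub_mul hm hl)
  have h2 : Integrable (fun x : unitInterval => l * ((x : ℝ) - m)) (P : Measure unitInterval) :=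
    integrable_of_continuous P (by fun_prop)
  have h3 : Integrable (fun x : unitInterval => l ^ 2 / 2 * ((x : ℝ) - m) ^ 2)
      (P : Measure unitInterval) := integrable_of_continuous P (by fun_prop)
  have e : (∫ x : unitInterval, Real.log (1 - l * ((x : ℝ) - m)) ∂(P : Measure unitInterval)) -
      (l * (m - mean P) -
        l ^ 2 / 2 * ∫ x : unitInterval, ((x : ℝ) - m) ^ 2 ∂(P : Measure unitInterval)) =
      ∫ x : unitInterval, (Real.log (1 - l * ((x : ℝ) - m)) + l * ((x : ℝ) - m) +
        l ^ 2 / 2 * ((x : ℝ) - m) ^ 2) ∂(P : Measure unitInterval) := by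
    have h12 : Integrable (fun x : unitInterval => Real.log (1 - l * ((x : ℝ) - m)) +
      l * ((x : ℝ) - m)) (P : Measure unitInterval) := h1.add h2
    rw [integral_add h12 h3, integral_add h1 h2, integral_const_mul, integral_const_mul,
      integral_sub_const_eq]
    ring
  rw [e]
  refine abs_integral_le_of_abs_le fun x => ?_
  have h := abs_log_one_sub_add_le (abs_mul_sub_le_half hm hl x)
  have hx : |l * ((x : ℝ) - m)| ≤ |l| := by
    rw [abs_mul]
    exact mul_le_of_le_one_right (abs_nonneg _) (abs_sub_le_one hm x)
  calc _ = |Real.log (1 - l * ((x : ℝ) - m)) + l * ((x : ℝ) - m) +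
        (l * ((x : ℝ) - m)) ^ 2 / 2| := by congr 1; ring
    _ ≤ 2 * |l * ((x : ℝ) - m)| ^ 3 := h
    _ ≤ _ := by gcongr

/-- First-order expansion of minus the derivative of the dual objective. -/
lemma abs_integral_div_sub_le {P : Dist01} {m l : ℝ} (hm : m ∈ Set.Ioo (0 : ℝ) 1)
    (hl : |l| ≤ 1 / 2) :
    |(∫ x : unitInterval, ((x : ℝ) - m) / (1 - l * ((x : ℝ) - m)) ∂(P : Measure unitInterval)) -
      (mean P - m + l * ∫ x : unitInterval, ((x : ℝ) - m) ^ 2 ∂(P : Measure unitInterval))| ≤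
      2 * l ^ 2 := by
  have h1 := integrable_of_continuous P (continuous_div_one_sub_mul hm hl)
  have h2 : Integrable (fun x : unitInterval => (x : ℝ) - m) (P : Measure unitInterval) :=
    integrable_of_continuous P (by fun_prop)
  have h3 : Integrable (fun x : unitInterval => l * ((x : ℝ) - m) ^ 2)
      (P : Measure unitInterval) := integrable_of_continuous P (by fun_prop)
  have e : (∫ x : unitInterval, ((x : ℝ) - m) / (1 - l * ((x : ℝ) - m))
      ∂(P : Measure unitInterval)) -
      (mean P - m + l * ∫ x : unitInterval, ((x : ℝ) - m) ^ 2 ∂(P : Measure unitInterval)) =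
      ∫ x : unitInterval, (((x : ℝ) - m) / (1 - l * ((x : ℝ) - m)) - ((x : ℝ) - m) -
        l * ((x : ℝ) - m) ^ 2) ∂(P : Measure unitInterval) := by
    have h12 : Integrable (fun x : unitInterval => ((x : ℝ) - m) / (1 - l * ((x : ℝ) - m)) -
      ((x : ℝ) - m)) (P : Measure unitInterval) := h1.sub h2
    rw [integral_sub h12 h3, integral_sub h1 h2, integral_const_mul, integral_sub_const_eq]
    ring
  rw [e]
  refine abs_integral_le_of_abs_le fun x => ?_
  have hx := abs_sub_le_one hm x
  have hy := half_le_one_sub_mul hm hl x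
  generalize (x : ℝ) - m = z at hx hy ⊢
  have hy0 : 0 < 1 - l * z := by linarith
  -- Exact geometric-series remainder; |z| ≤ 1 and 1 - lz ≥ 1/2 bound it by 2 l².
  have e2 : z / (1 - l * z) - z - l * z ^ 2 = l ^ 2 * z ^ 3 / (1 - l * z) := by
    rw [eq_div_iff hy0.ne', sub_mul, sub_mul, div_mul_cancel₀ _ hy0.ne']
    ring
  rw [e2, abs_div, abs_of_pos hy0, div_le_iff₀ hy0, abs_mul, abs_of_nonneg (sq_nonneg l), abs_pow]
  have h3 : |z| ^ 3 ≤ 1 := pow_le_one₀ (abs_nonneg _) hx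
  nlinarith [sq_nonneg l]

/-! ### Small stationary points along the sequence -/

lemma continuousOn_integral_div {P : Dist01} {m : ℝ} (hm : m ∈ Set.Ioo (0 : ℝ) 1) :
    ContinuousOn (fun l : ℝ => ∫ x : unitInterval, ((x : ℝ) - m) / (1 - l * ((x : ℝ) - m))
      ∂(P : Measure unitInterval)) (Set.Icc 0 (1 / 2)) := by
  have habs : ∀ l ∈ Set.Icc (0 : ℝ) (1 / 2), |l| ≤ 1 / 2 := fun l hl => by
    rw [abs_of_nonneg hl.1]; exact hl.2
  refine continuousOn_of_dominated (bound := fun _ => 2) (fun l hl => ?_)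
    (fun l hl => ae_of_all _ fun x => ?_) (integrable_const _) (ae_of_all _ fun x => ?_)
  · exact (continuous_div_one_sub_mul hm (habs l hl)).aestronglyMeasurable
  · have hy := half_le_one_sub_mul hm (habs l hl) x
    rw [Real.norm_eq_abs, abs_div, abs_of_pos (by linarith : 0 < 1 - l * ((x : ℝ) - m)),
      div_le_iff₀ (by linarith)]
    linarith [abs_sub_le_one hm x]
  · refine ContinuousOn.div (by fun_prop) (by fun_prop) fun l hl => ?_
    linarith [half_le_one_sub_mul hm (habs l hl) x]

/-- Intermediate value theorem on [0, ε]: the integral is negative at 0, and the hypothesis `h`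
makes its first-order expansion, error included, nonnegative at ε. -/
lemma exists_stationary {P : Dist01} {m ε : ℝ} (hm : m ∈ Set.Ioo (0 : ℝ) 1) (hP : mean P < m)
    (hε0 : 0 < ε) (hε : ε ≤ 1 / 2)
    (h : m - mean P ≤
      ε * (∫ x : unitInterval, ((x : ℝ) - m) ^ 2 ∂(P : Measure unitInterval)) - 2 * ε ^ 2) :
    ∃ l, 0 < l ∧ l ≤ ε ∧ ∫ x : unitInterval, ((x : ℝ) - m) / (1 - l * ((x : ℝ) - m))
      ∂(P : Measure unitInterval) = 0 := by
  have hc := (continuousOn_integral_div (P := P) hm).mono (Set.Icc_subset_Icc_right hε)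
  have h0 : ∫ x : unitInterval, ((x : ℝ) - m) / (1 - 0 * ((x : ℝ) - m))
      ∂(P : Measure unitInterval) < 0 := by
    simp only [zero_mul, sub_zero, div_one]
    rw [integral_sub_const_eq]; linarith
  have h1 := (abs_le.1 (abs_integral_div_sub_le (P := P) hm
    (by rwa [abs_of_pos hε0] : |ε| ≤ 1 / 2))).1
  obtain ⟨l, hl, hl0⟩ := intermediate_value_Icc hε0.le hc
    (show (0 : ℝ) ∈ Set.Icc _ _ from ⟨h0.le, by linarith⟩)
  refine ⟨l, lt_of_le_of_ne hl.1 ?_, hl.2, hl0⟩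
  rintro rfl
  exact h0.ne hl0

lemma tendsto_integral_of_continuous {P : ℕ → Dist01} {Pinf : Dist01}
    (h : Tendsto P atTop (𝓝 Pinf)) {f : unitInterval → ℝ} (hf : Continuous f) :
    Tendsto (fun n => ∫ x, f x ∂(P n : Measure unitInterval)) atTop
      (𝓝 (∫ x, f x ∂(Pinf : Measure unitInterval))) :=
  ProbabilityMeasure.tendsto_iff_forall_integral_tendsto.1 h
    (BoundedContinuousFunction.mkOfCompact ⟨f, hf⟩)

lemma tendsto_log_div {m : ℝ} :
    Tendsto (fun l : ℝ => Real.log ((1 + l * m) / (1 - l * (1 - m))) / l) (𝓝[≠] 0) (𝓝 1) := by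
  have hd : HasDerivAt (fun l : ℝ => Real.log ((1 + l * m) / (1 - l * (1 - m)))) 1 0 := by
    have h1 : HasDerivAt (fun l : ℝ => 1 + l * m) m 0 := by
      simpa using ((hasDerivAt_id (0 : ℝ)).mul_const m).const_add 1
    have h2 : HasDerivAt (fun l : ℝ => 1 - l * (1 - m)) (-(1 - m)) 0 := by
      simpa using ((hasDerivAt_id (0 : ℝ)).mul_const (1 - m)).const_sub 1
    refine ((h1.div h2 (by simp)).log (by simp)).congr_deriv ?_
    simp [Pi.div_apply]
  have := hd.tendsto_slope
  refine this.congr fun l => ?_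
  simp [slope_def_field]

/-- The dual maximizers are eventually small, positive, and stationary. -/
lemma eventually_stationary {m : ℝ} (hm : m ∈ Set.Ioo (0 : ℝ) 1)
    {P : ℕ → Dist01} (hmean : ∀ n, mean (P n) < m)
    (hmean0 : Tendsto (fun n => mean (P n)) atTop (𝓝 m)) {v : ℝ} (hv : 0 < v)
    (hsq : Tendsto (fun n => ∫ x : unitInterval, ((x : ℝ) - m) ^ 2 ∂(P n : Measure unitInterval))
      atTop (𝓝 v))
    {lam : ℕ → ℝ} (hlam : ∀ n, IsDualMaximizer (P n) m (lam n)) {ε : ℝ} (hε : 0 < ε) :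
    ∀ᶠ n in atTop, 0 < lam n ∧ lam n ≤ ε ∧ lam n ≤ 1 / 2 ∧
      ∫ x : unitInterval, ((x : ℝ) - m) / (1 - lam n * ((x : ℝ) - m))
        ∂(P n : Measure unitInterval) = 0 := by
  -- Once E[Z²] > v/2, the bound δ ≤ v/8 gives δ E[Z²] - 2δ² ≥ δ v/4, which eventually exceeds m -
  -- `mean (P n)`.
  obtain ⟨δ, hδ0, hδε, hδ2, hδv⟩ : ∃ δ : ℝ, 0 < δ ∧ δ ≤ ε ∧ δ ≤ 1 / 2 ∧ δ ≤ v / 8 :=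
    ⟨min ε (min (1 / 2) (v / 8)), by positivity, min_le_left _ _,
      (min_le_right _ _).trans (min_le_left _ _), (min_le_right _ _).trans (min_le_right _ _)⟩
  have ev1 := hsq.eventually (lt_mem_nhds (show v / 2 < v by linarith))
  have ev2 := hmean0.eventually (lt_mem_nhds (show m - δ * (v / 4) < m by
    have : 0 < δ * (v / 4) := by positivity
    linarith))
  filter_upwards [ev1, ev2] with n h1 h2
  obtain ⟨l, hl0, hlδ, hst⟩ := exists_stationary hm (hmean n) hδ0 hδ2 (by nlinarith)
  have hl2 : |l| ≤ 1 / 2 := by rw [abs_of_pos hl0]; linarith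
  have : lam n = l := (hlam n).unique hm (hmean n).ne (isDualMaximizer_of_stationary hm hl2 hst)
  rw [this]
  exact ⟨hl0, hlδ.trans hδε, hlδ.trans hδ2, hst⟩

/-- The maximizer over the whole dual domain already lies in [-1, 1], so restricting the range loses
nothing. -/
lemma klInfTilde_eq_of_stationary {P : Dist01} {m l : ℝ} (hm : m ∈ Set.Ioo (0 : ℝ) 1)
    (hl : |l| ≤ 1 / 2)
    (hst : ∫ x : unitInterval, ((x : ℝ) - m) / (1 - l * ((x : ℝ) - m))
      ∂(P : Measure unitInterval) = 0) :
    klInfTilde P m = ((∫ x : unitInterval, Real.log (1 - l * ((x : ℝ) - m))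
      ∂(P : Measure unitInterval) : ℝ) : EReal) := by
  have hl' := abs_le.1 hl
  rw [← dualObjective_eq_integral_of_abs_le hm hl]
  refine le_antisymm (iSup₂_le fun k hk => ?_) ?_
  · exact (isDualMaximizer_of_stationary hm hl hst).2 (Icc_subset_dualDomain hm hk)
  · exact le_iSup₂_of_le l ⟨by linarith, by linarith⟩ le_rfl

end BoundedMean

/-! ### The asymptotic statements -/

theorem mainTheorem8 (m : ℝ) (hm : m ∈ Set.Ioo (0 : ℝ) 1)
    (P : ℕ → Dist01) (Pinf : Dist01)
    (hmean : ∀ n, mean (P n) < m)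
    (hconv : Filter.Tendsto P Filter.atTop (nhds Pinf))
    (hmeanInf : mean Pinf = m)
    (hvar : 0 < ProbabilityTheory.variance (fun x : unitInterval => (x : ℝ))
      (Pinf : Measure unitInterval)) :
    (∀ n, 0 < klInf (P n) m ∧ klInf (P n) m < ⊤) ∧
    (∀ n, ∃! l : ℝ, IsDualMaximizer (P n) m l) ∧
    ∀ lam : ℕ → ℝ, (∀ n, IsDualMaximizer (P n) m (lam n)) →
      (fun n => (klInf (P n) m).toReal -
          1 / 2 * ((∫ x, ((x : ℝ) - m) ∂(P n : Measure unitInterval)) ^ 2 /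
            ∫ x, ((x : ℝ) - m) ^ 2 ∂(P n : Measure unitInterval)))
        =o[Filter.atTop] (fun n => (lam n) ^ 2) ∧
      Filter.Tendsto
        (fun n => (Real.log ((1 + lam n * m) / (1 - lam n * (1 - m)))) ^ 2 /
          (2 * (klInf (P n) m).toReal))
        Filter.atTop
        (nhds (1 / ProbabilityTheory.variance (fun x : unitInterval => (x : ℝ))
          (Pinf : Measure unitInterval))) ∧
      Filter.Tendsto (fun n => (klInfTilde (P n) m).toReal / (klInf (P n) m).toReal)
        Filter.atTop (nhds 1) := by
  refine ⟨fun n => ⟨klInf_pos hm (hmean n), klInf_lt_top hm (hmean n)⟩, fun n => ?_, ?_⟩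
  · obtain ⟨l, hl⟩ := exists_isDualMaximizer (P n) hm
    exact ⟨l, hl, fun k hk => hk.unique hm (hmean n).ne hl⟩
  intro lam hlam
  have hVar : ProbabilityTheory.variance (fun x : unitInterval => (x : ℝ))
      (Pinf : Measure unitInterval) =
      ∫ x : unitInterval, ((x : ℝ) - m) ^ 2 ∂(Pinf : Measure unitInterval) := by
    rw [ProbabilityTheory.variance_eq_integral (by fun_prop)]
    change ∫ x : unitInterval, ((x : ℝ) - mean Pinf) ^ 2 ∂(Pinf : Measure unitInterval) = _
    rw [hmeanInf]
  have hsq := tendsto_integral_of_continuous hconv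
    (f := fun x : unitInterval => ((x : ℝ) - m) ^ 2) (by fun_prop)
  rw [← hVar] at hsq
  have hmean0 : Filter.Tendsto (fun n => mean (P n)) Filter.atTop (nhds m) := by
    have := tendsto_integral_of_continuous hconv
      (f := fun x : unitInterval => (x : ℝ)) (by fun_prop)
    rwa [← hmeanInf]
  generalize ProbabilityTheory.variance (fun x : unitInterval => (x : ℝ))
      (Pinf : Measure unitInterval) = σ at hvar hsq ⊢
  have hev := fun {ε : ℝ} (hε : 0 < ε) => eventually_stationary hm hmean hmean0 hvar hsq hlam hε
  have hlam0 : Filter.Tendsto lam Filter.atTop (nhds 0) := by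
    refine Metric.tendsto_nhds.2 fun ε hε => ?_
    filter_upwards [hev (half_pos hε)] with n hn
    rw [Real.dist_eq, sub_zero, abs_of_pos hn.1]
    linarith [hn.2.1]
  have hst := hev one_pos
  have hlamne : Filter.Tendsto lam Filter.atTop (nhdsWithin 0 {0}ᶜ) :=
    tendsto_nhdsWithin_iff.2 ⟨hlam0, hst.mono fun n hn => hn.1.ne'⟩
  set v : ℕ → ℝ := fun n =>
    ∫ x : unitInterval, ((x : ℝ) - m) ^ 2 ∂(P n : Measure unitInterval) with hv
  set K : ℕ → ℝ := fun n => (klInf (P n) m).toReal with hK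
  have hKpos : ∀ n, 0 < K n := fun n =>
    ENNReal.toReal_pos (klInf_pos hm (hmean n)).ne' (klInf_lt_top hm (hmean n)).ne
  have hKeq : ∀ᶠ n in Filter.atTop, K n = ∫ x : unitInterval, Real.log (1 - lam n * ((x : ℝ) - m))
      ∂(P n : Measure unitInterval) := by
    filter_upwards [hst] with n hn
    have hk := klInf_eq_of_stationary hm (by rw [abs_of_pos hn.1]; exact hn.2.2.1) hn.2.2.2
    have h0 := hKpos n
    simp only [hK] at h0 ⊢
    rw [hk] at h0 ⊢
    rw [ENNReal.toReal_ofReal']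
    rw [ENNReal.toReal_ofReal'] at h0
    -- `ENNReal.ofReal` truncates at 0; positivity of `klInf` shows that the truncation is inactive.
    exact max_eq_left (le_of_lt (by simpa using h0))
  -- The first-order expansion at a stationary point reads 0 = E[Z] + λ v + O(λ²); divide by λ.
  have hratio : Filter.Tendsto (fun n => (m - mean (P n)) / lam n) Filter.atTop (nhds σ) := by
    have hz : Filter.Tendsto (fun n => (m - mean (P n)) / lam n - v n) Filter.atTop (nhds 0) := by
      refine squeeze_zero_norm' (a := fun n => 2 * lam n) ?_ (by simpa using hlam0.const_mul 2)
      filter_upwards [hst] with n hn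
      have h := abs_integral_div_sub_le (P := P n) hm
        (by rw [abs_of_pos hn.1]; exact hn.2.2.1 : |lam n| ≤ 1 / 2)
      rw [hn.2.2.2] at h
      have e : (m - mean (P n)) / lam n - v n =
          (0 - (mean (P n) - m + lam n * v n)) / lam n := by
        have := hn.1.ne'
        field_simp; ring
      rw [Real.norm_eq_abs, e, abs_div, abs_of_pos hn.1, div_le_iff₀ hn.1]
      refine h.trans (le_of_eq ?_)
      ring
    simpa using hz.add hsq
  -- Dividing KL_inf = λ (m - mean) - λ² v/2 + O(λ³) by λ² gives the limit σ - σ/2.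
  have hKratio : Filter.Tendsto (fun n => K n / lam n ^ 2) Filter.atTop (nhds (σ / 2)) := by
    have hz : Filter.Tendsto (fun n => K n / lam n ^ 2 - ((m - mean (P n)) / lam n - v n / 2)) Filter.atTop
        (nhds 0) := by
      refine squeeze_zero_norm' (a := fun n => 2 * lam n) ?_ (by simpa using hlam0.const_mul 2)
      filter_upwards [hst, hKeq] with n hn hk
      have h := abs_integral_log_sub_le (P := P n) hm
        (by rw [abs_of_pos hn.1]; exact hn.2.2.1 : |lam n| ≤ 1 / 2)
      rw [← hk, abs_of_pos hn.1] at h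
      have hp : 0 < lam n ^ 2 := pow_pos hn.1 2
      have e : K n / lam n ^ 2 - ((m - mean (P n)) / lam n - v n / 2) =
          (K n - (lam n * (m - mean (P n)) - lam n ^ 2 / 2 * v n)) / lam n ^ 2 := by
        have := hn.1.ne'
        field_simp
      rw [Real.norm_eq_abs, e, abs_div, abs_of_pos hp, div_le_iff₀ hp]
      refine h.trans (le_of_eq ?_)
      ring
    have h := hz.add (hratio.sub (hsq.div_const 2))
    rw [show 0 + (σ - σ / 2) = σ / 2 by ring] at h
    exact h.congr fun n => by simp only [hv]; ring
  refine ⟨?_, ?_, ?_⟩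
  · rw [Asymptotics.isLittleO_iff_tendsto' (hst.mono fun n hn h0 =>
      absurd h0 (pow_pos hn.1 2).ne')]
    -- After division by λ², both KL_inf and its quadratic approximation tend to σ/2.
    have h := hKratio.sub (((hratio.pow 2).div hsq hvar.ne').const_mul (1 / 2))
    rw [show σ / 2 - 1 / 2 * (σ ^ 2 / σ) = 0 by field_simp; ring] at h
    refine h.congr' ?_
    filter_upwards [hst] with n hn
    have := hn.1.ne'
    rw [integral_sub_const_eq]
    simp only [Pi.div_apply]
    change _ = (K n - 1 / 2 * ((mean (P n) - m) ^ 2 / v n)) / _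
    ring
  · have h := ((tendsto_log_div (m := m)).comp hlamne).pow 2 |>.div (hKratio.const_mul 2)
      (by positivity)
    rw [show (1 : ℝ) ^ 2 / (2 * (σ / 2)) = 1 / σ by field_simp] at h
    refine h.congr' ?_
    filter_upwards [hst] with n hn
    have := hn.1.ne'
    have := (hKpos n).ne'
    simp only [Function.comp, Pi.div_apply]
    change _ = _ / (2 * K n)
    generalize Real.log ((1 + lam n * m) / (1 - lam n * (1 - m))) = L
    field_simp
  -- The ratio is eventually equal to 1, not merely convergent to it.
  · refine tendsto_const_nhds.congr' ?_
    filter_upwards [hst, hKeq] with n hn hk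
    rw [klInfTilde_eq_of_stationary hm (by rw [abs_of_pos hn.1]; exact hn.2.2.1) hn.2.2.2,
      EReal.toReal_coe, ← hk]
    exact (div_self (hKpos n).ne').symm
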